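/- Let $b=(b_0,b_1,\dots,b_m)$ ($m\ge 0$) be a sequence of positive integers, put $n:=b_0$, $e_k:=\gcd(b_0,\dots,b_k)$, $U_n:=\{\varepsilon\in\mathbb{C}:\varepsilon^n=1\}$ and $$I:=e_0\mathbb{N}_{+}\cup\bigcup_{k=1}^m \bigl(e_k\mathbb{N}\cap[b_k,+\infty)\bigr).$$ A pair $(T^n,\alpha(T))$ with $\alpha=\sum_{i\ge 1}a_iT^i\in\mathbb{C}[[T]]$, $\operatorname{supp}\alpha:=\{i:a_i\ne 0\}$, is called a Puiseux parametrisation if $\gcd(\{n\}\cup\operatorname{supp}\alpha)=1$, and a Puiseux parametrisation of the curve $f(x,y)=0$ if moreover $f(T^n,\alpha(T))=0$. It has characteristic $(b_0,\dots,b_m)$ if $b_0=n$, $b_{k+1}=\min(\operatorname{supp}\alpha\setminus e_k\mathbb{N})$ for $0\le k<m$, and $e_m=1$. Let $\widehat{\mathcal F}(b_0,\dots,b_m)$ be the set of irreducible $f=\sum_{i,j\ge 0} c_{ij}X^iY^j\in\mathbb{C}[[X,Y]]$ with $c_{0j}=0$ for $j<n$ and $c_{0n}\neq 0$ such that $f=u_fw_f$,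 where $u_f\in\mathbb{C}[[X,Y]]$ is invertible and $w_f$ is an irreducible Weierstrass polynomial in $Y$ of degree $n$ (monic in $Y$, with all its other coefficients in $\mathbb{C}[[X]]$ having zero constant term) such that the curve $w_f(x,y)=0$ has a Puiseux parametrisation $(T^n,\alpha(T))$ of characteristic $(b_0,\dots,b_m)$. Theorem. Let $\{i_1,\dots,i_s\}$ be a finite subset of $I$ and let $Q\in\mathbb{C}[A_{i_1},\dots,A_{i_s}]$ be a polynomial such that, for every $\varepsilon\in U_n$ and all complex values of the variables, $$Q(A_{i_1},\dots,A_{i_s})=0\iff Q(\varepsilon^{i_1}A_{i_1},\dots,\varepsilon^{i_s}A_{i_s})=0 .$$ Then there exist a finite subset $\{\gamma_1,\dots,\gamma_t\}$ of $\mathbb{N}^2$ (where $0\in\mathbb{N}$) and a polynomial $W\in\mathbb{C}[C_{\gamma_1},\dots,C_{\gamma_t}]$ such that, for every $f=\sum c_{ij}X^iY^j\in\widehat{\mathcal F}(b_0,\dots,b_m)$ and every Puiseux parametrisation $(T^n,\sum_{i\ge 1} a_iT^i)$ of the curve $f(x,y)=0$, $$Q(a_{i_1},\dots,a_{i_s})=0\iff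 W(c_{\gamma_1},\dots,c_{\gamma_t})=0 .$$ Equivalently, the non-degeneracy condition $Q(a_{i_1},\dots,a_{i_s})\neq 0$ on the Puiseux coefficients is the polynomial condition $W(c_{\gamma_1},\dots,c_{\gamma_t})\neq 0$ on the coefficients of $f$. -/

import Mathlib

namespace PlaneBranch

/-- The ring `ℂ[[X,Y]]`; the variable `X` has index `0` and `Y` has index `1`. -/
abbrev Series2 : Type := MvPowerSeries (Fin 2) ℂ

/-- The coefficient `c_{ij}` of `X^i Y^j` in `f`. -/
noncomputable def coeffXY (f : Series2) (i j : ℕ) : ℂ :=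
  MvPowerSeries.coeff (Finsupp.single 0 i + Finsupp.single 1 j) f

/-- The support of a power series in one variable. -/
def supp (α : PowerSeries ℂ) : Set ℕ := {i | PowerSeries.coeff i α ≠ 0}

/-- `(T^n, α(T))` is a Puiseux parametrisation: `n` is positive, `α` has no constant term, and
`gcd ({n} ∪ supp α) = 1`, that is, the only common divisor of `n` and all elements of the support
of `α` is `1`. -/
structure IsPuiseux (n : ℕ) (α : PowerSeries ℂ) : Prop where
  pos : 0 < n
  constantCoeff_eq_zero : PowerSeries.constantCoeff α = 0
  gcd_eq_one : ∀ d : ℕ, d ∣ n → (∀ i ∈ supp α, d ∣ i) → d = 1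

/-- The formal power series `f(T^n, α(T))`. (This is the usual substitution when `0 < n` and `α`
has no constant term, in particular for every Puiseux parametrisation.) -/
noncomputable def substPair (n : ℕ) (α : PowerSeries ℂ) (f : Series2) : PowerSeries ℂ :=
  MvPowerSeries.subst (![PowerSeries.X ^ n, α] : Fin 2 → PowerSeries ℂ) f

/-- `(T^n, α(T))` is a Puiseux parametrisation of the curve `f(x,y) = 0`. -/
def IsPuiseuxOf (f : Series2) (n : ℕ) (α : PowerSeries ℂ) : Prop :=
  IsPuiseux n α ∧ substPair n α f = 0

/-- `e_k = gcd (b_0, …, b_k)`. -/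
def e {m : ℕ} (b : Fin (m + 1) → ℕ) (k : Fin (m + 1)) : ℕ := (Finset.Iic k).gcd b

/-- `(b_0, …, b_m)` is the characteristic of the Puiseux parametrisation `(T^n, α(T))`:
`b_0 = n`, `b_{k+1} = min (supp α \ gcd (b_0, …, b_k) ℕ)`, and `gcd (b_0, …, b_m) = 1`. -/
structure IsCharacteristic (n : ℕ) (α : PowerSeries ℂ) {m : ℕ} (b : Fin (m + 1) → ℕ) : Prop where
  zero : b 0 = n
  succ : ∀ k : Fin m, IsLeast {i | i ∈ supp α ∧ ¬ e b k.castSucc ∣ i} (b k.succ)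
  last : e b (Fin.last m) = 1

/-- `w = Y^n + c_1(X) Y^{n-1} + ⋯ + c_n(X)` with power series `c_i(X)` without constant terms. -/
structure IsWeierstrassPoly (n : ℕ) (w : Series2) : Prop where
  monic : ∀ i : ℕ, coeffXY w i n = if i = 0 then 1 else 0
  degree_le : ∀ i j : ℕ, n < j → coeffXY w i j = 0
  constantCoeff_eq_zero : ∀ j : ℕ, j < n → coeffXY w 0 j = 0

/-- The class `𝓕(b_0, …, b_m)` of irreducible Weierstrass polynomials (of degree `b_0`) with
characteristic `(b_0, …, b_m)`, i.e. possessing a Puiseux parametrisation of that characteristic.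
(All Puiseux parametrisations of an irreducible Weierstrass polynomial have the same
characteristic.) -/
def ClassF {m : ℕ} (b : Fin (m + 1) → ℕ) : Set Series2 :=
  {w | Irreducible w ∧ IsWeierstrassPoly (b 0) w ∧
    ∃ α : PowerSeries ℂ, IsPuiseuxOf w (b 0) α ∧ IsCharacteristic (b 0) α b}

/-- `w` is the Weierstrass polynomial `w_f` of `f`, of degree `n > 0`: `c_{0j} = 0` for `j < n`,
`c_{0n} ≠ 0`, and `f = u w` with `u` invertible and `w` a Weierstrass polynomial of degree `n`. -/
structure IsWeierstrassPolyOf (f : Series2) (n : ℕ) (w : Series2) : Prop where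
  pos : 0 < n
  coeff_lt : ∀ j : ℕ, j < n → coeffXY f 0 j = 0
  coeff_ne : coeffXY f 0 n ≠ 0
  isWeierstrassPoly : IsWeierstrassPoly n w
  factor : ∃ u : Series2, IsUnit u ∧ f = u * w

/-- The class of irreducible power series `f` whose Weierstrass polynomial `w_f` exists and belongs
to `𝓕(b_0, …, b_m)`. -/
def ClassFHat {m : ℕ} (b : Fin (m + 1) → ℕ) : Set Series2 :=
  {f | Irreducible f ∧ ∃ w : Series2, IsWeierstrassPolyOf f (b 0) w ∧ w ∈ ClassF b}

/-- `I = e_0 ℕ₊ ∪ ⋃_{k=1}^m (e_k ℕ ∩ [b_k, ∞))`. -/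
def indexSet {m : ℕ} (b : Fin (m + 1) → ℕ) : Set ℕ :=
  {i | 0 < i ∧ e b 0 ∣ i} ∪ ⋃ k : Fin m, {i | e b k.succ ∣ i ∧ b k.succ ≤ i}

end PlaneBranch

/-! The coefficients c_ij of f and a_i of α are regarded as functions on the set of all pairs (f,
α). Let G be the ring of quotients, with nowhere vanishing denominator, of polynomials in the c_ij.
The heart of the proof is a single unit v with v^n ∈ G and a_j ∈ v^j G for all the j needed. Then
the product of Q(ω^j a_j) over ω^n = 1 is a norm and lies in G (`prod_aeval_smul_mem`). Its
numerator is W: it vanishes iff some factor does, and by the invariance of Q this means Q(a) = 0.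

To find v, Weierstrass division over G gives a monic equation of degree n for α with coefficients in
G[[T^n]], whose roots are the n conjugates α(εT). By Newton's identities the coefficients of α^j at
T^(nl) lie in G (`coeff_pow_mem`), and this persists for all series built from G, T^n and α.

The a_i are then found by induction on i (`Stage`). With e the gcd of n and the characteristic
exponents below i, the truncation of α below T^i is a polynomial in v T^e over G. Its norm equation
evaluated at α has leading coefficient a_i times a known unit (`Stage.exists_mem_hasLeadingTerm`).
Moving the leading exponent of a power of this value into nℕ places a power of a_i in a known v^l G
(`Stage.hasDegree_pow_coeff`). At a characteristic exponent a_i never vanishes, and a Bézout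
combination of v and a_i is the new v (`Stage.succ_of_isUnit`). After the last one, e = 1. -/

namespace PlaneBranch

open PowerSeries

/-! ### Norms under roots of unity -/

/-- The norm of a polynomial under the rotations `z ↦ ω z`, `ω ^ N = 1`, takes values in `L` at
every point whose `N`-th power is in `L`. -/
theorem prod_aeval_smul_mem {K : Type*} [CommRing K] [Algebra ℂ K] (L : Subalgebra ℂ K)
    (P : Polynomial L) {N : ℕ} (hN : 0 < N) (z : K) (hz : z ^ N ∈ L) :
    ∏ ω ∈ Polynomial.nthRootsFinset N (1 : ℂ), Polynomial.aeval (ω • z) P ∈ L := by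
  classical
  set S := Polynomial.nthRootsFinset N (1 : ℂ)
  set R : Polynomial L :=
    ∏ ω ∈ S, P.comp (Polynomial.C (algebraMap ℂ L ω) * Polynomial.X) with hR
  have hev : ∏ ω ∈ S, Polynomial.aeval (ω • z) P = Polynomial.aeval z R := by
    rw [hR, map_prod]
    refine Finset.prod_congr rfl fun ω _ => ?_
    rw [Polynomial.aeval_comp]
    congr 1
    simp only [map_mul, Polynomial.aeval_C, Polynomial.aeval_X]
    rw [← IsScalarTower.algebraMap_apply, Algebra.smul_def]
  obtain ⟨ζ, hζ⟩ : ∃ ζ : ℂ, IsPrimitiveRoot ζ N := ⟨_, Complex.isPrimitiveRoot_exp N hN.ne'⟩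
  have hζ0 : ζ ≠ 0 := hζ.ne_zero hN.ne'
  -- Multiplication by ζ permutes the roots of unity, so R(ζX) = R and only the powers of X
  -- divisible by N occur in R.
  have hinv : R.comp (Polynomial.C (algebraMap ℂ L ζ) * Polynomial.X) = R := by
    rw [hR, Polynomial.prod_comp]
    refine Finset.prod_bij' (fun ω _ => ω * ζ) (fun ω _ => ω * ζ⁻¹) ?_ ?_ ?_ ?_ ?_
    · intro ω hω
      rw [Polynomial.mem_nthRootsFinset hN] at hω ⊢
      rw [mul_pow, hω, hζ.pow_eq_one, one_mul]
    · intro ω hω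
      rw [Polynomial.mem_nthRootsFinset hN] at hω ⊢
      rw [mul_pow, hω, inv_pow, hζ.pow_eq_one, inv_one, one_mul]
    · intro ω _; simp [hζ0]
    · intro ω _; simp [hζ0]
    · intro ω _
      rw [Polynomial.comp_assoc]
      congr 1
      simp [map_mul, mul_assoc]
  have hcoeff : ∀ l, ¬ N ∣ l → R.coeff l = 0 := by
    intro l hl
    have h1 := congrArg (fun p => Polynomial.coeff p l) hinv
    simp only [Polynomial.comp_C_mul_X_coeff] at h1
    have h2 : (ζ ^ l - 1) • R.coeff l = 0 := by
      rw [Algebra.smul_def, map_sub, map_pow, map_one, sub_mul, one_mul, mul_comm, h1, sub_self]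
    have h3 : ζ ^ l - 1 ≠ 0 := fun h => hl (hζ.dvd_of_pow_eq_one l (sub_eq_zero.1 h))
    exact (smul_eq_zero_iff_right h3).1 h2
  rw [hev, Polynomial.aeval_eq_sum_range]
  refine L.sum_mem fun l _ => ?_
  by_cases hl : N ∣ l
  · obtain ⟨k, rfl⟩ := hl
    rw [pow_mul]
    exact L.mul_mem (R.coeff _).2 (L.pow_mem hz k)
  · rw [hcoeff l hl, zero_smul]; exact L.zero_mem

/-! ### Leading terms of power series -/

section LeadingTerm

variable {R : Type*} [CommRing R]

/-- `z = c T^q + (terms of higher order)`; the coefficient `c` may vanish. -/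
def HasLeadingTerm (z : R⟦X⟧) (q : ℕ) (c : R) : Prop :=
  ∃ y : R⟦X⟧, z = X ^ q * y ∧ constantCoeff y = c

theorem HasLeadingTerm.mul {z z' : R⟦X⟧} {q q' : ℕ} {c c' : R} (h : HasLeadingTerm z q c)
    (h' : HasLeadingTerm z' q' c') : HasLeadingTerm (z * z') (q + q') (c * c') := by
  obtain ⟨y, rfl, rfl⟩ := h
  obtain ⟨y', rfl, rfl⟩ := h'
  exact ⟨y * y', by ring, by simp⟩

theorem HasLeadingTerm.one : HasLeadingTerm (1 : R⟦X⟧) 0 1 := ⟨1, by simp, by simp⟩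

theorem HasLeadingTerm.pow {z : R⟦X⟧} {q : ℕ} {c : R} (h : HasLeadingTerm z q c) (k : ℕ) :
    HasLeadingTerm (z ^ k) (q * k) (c ^ k) := by
  obtain ⟨y, rfl, rfl⟩ := h
  exact ⟨y ^ k, by rw [mul_pow, pow_mul], by simp⟩

theorem HasLeadingTerm.coeff {z : R⟦X⟧} {q : ℕ} {c : R} (h : HasLeadingTerm z q c) :
    PowerSeries.coeff q z = c := by
  obtain ⟨y, rfl, rfl⟩ := h
  have := PowerSeries.coeff_X_pow_mul y q 0
  simpa using this

theorem HasLeadingTerm.of_coeff {z : R⟦X⟧} {q : ℕ} (h : ∀ j < q, PowerSeries.coeff j z = 0) :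
    HasLeadingTerm z q (PowerSeries.coeff q z) := by
  obtain ⟨y, rfl⟩ := PowerSeries.X_pow_dvd_iff.2 h
  exact ⟨y, rfl, HasLeadingTerm.coeff ⟨y, rfl, rfl⟩ |>.symm⟩

end LeadingTerm

/-! ### The grading by powers of a unit -/

section HasDegree

variable {R : Type*} [CommRing R] [Algebra ℂ R] {G : Subalgebra ℂ R} {v : Rˣ}

/-- `F ∈ v ^ l G`. -/
def HasDegree (G : Subalgebra ℂ R) (v : Rˣ) (l : ℤ) (F : R) : Prop :=
  F * ((v ^ (-l) : Rˣ) : R) ∈ G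

theorem HasDegree.zero (l : ℤ) : HasDegree G v l 0 := by
  simp [HasDegree, G.zero_mem]

theorem HasDegree.one : HasDegree G v 0 1 := by
  simp [HasDegree, G.one_mem]

theorem hasDegree_zero_iff {F : R} : HasDegree G v 0 F ↔ F ∈ G := by
  simp [HasDegree]

theorem HasDegree.mul {l l' : ℤ} {F F' : R} (h : HasDegree G v l F) (h' : HasDegree G v l' F') :
    HasDegree G v (l + l') (F * F') := by
  have := G.mul_mem h h'
  unfold HasDegree
  rw [neg_add, zpow_add, Units.val_mul]
  convert this using 1
  ring

theorem HasDegree.pow {l : ℤ} {F : R} (h : HasDegree G v l F) (k : ℕ) :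
    HasDegree G v (l * k) (F ^ k) := by
  induction k with
  | zero => simpa using HasDegree.one
  | succ k ih =>
    rw [pow_succ]
    convert ih.mul h using 1
    push_cast
    ring

theorem HasDegree.algebraMap_mul {l : ℤ} {F : R} (h : HasDegree G v l F) (x : ℂ) :
    HasDegree G v l (algebraMap ℂ R x * F) := by
  simpa using (hasDegree_zero_iff.2 (G.algebraMap_mem x)).mul h

/-- The ring `G` is assumed closed under inverses of those of its elements that are units of `R`;
this is applied to c v^(-l). -/
theorem HasDegree.inv (hG : ∀ u : Rˣ, (u : R) ∈ G → ((u⁻¹ : Rˣ) : R) ∈ G) {l : ℤ} {c : Rˣ}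
    (h : HasDegree G v l c) : HasDegree G v (-l) ((c⁻¹ : Rˣ) : R) := by
  have := hG (c * v ^ (-l)) (by simpa [HasDegree] using h)
  unfold HasDegree
  rw [← Units.val_mul]
  convert this using 2
  rw [mul_inv, ← zpow_neg]

theorem HasDegree.zpow (hG : ∀ u : Rˣ, (u : R) ∈ G → ((u⁻¹ : Rˣ) : R) ∈ G) {l : ℤ} {c : Rˣ}
    (h : HasDegree G v l c) (k : ℤ) : HasDegree G v (l * k) ((c ^ k : Rˣ) : R) := by
  obtain ⟨k, rfl | rfl⟩ := k.eq_nat_or_neg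
  · simpa using h.pow k
  · simpa using ((inv hG h).pow k)

theorem HasDegree.of_unit_mul (hG : ∀ u : Rˣ, (u : R) ∈ G → ((u⁻¹ : Rˣ) : R) ∈ G) {l l' : ℤ}
    {c : Rˣ} {F : R} (h : HasDegree G v l c) (h' : HasDegree G v l' (c * F)) :
    HasDegree G v (l' - l) F := by
  have := (HasDegree.inv hG h).mul h'
  rwa [Units.inv_mul_cancel_left, neg_add_eq_sub] at this

/-- If `v` itself has degree `k` with respect to `v'`, all degrees get multiplied by `k`. -/
theorem HasDegree.change (hG : ∀ u : Rˣ, (u : R) ∈ G → ((u⁻¹ : Rˣ) : R) ∈ G) {v' : Rˣ} {k l : ℤ}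
    (hv : HasDegree G v' k v) {F : R} (h : HasDegree G v l F) : HasDegree G v' (k * l) F := by
  have := (HasDegree.zpow hG hv l).mul (hasDegree_zero_iff.2 h)
  rw [add_zero, zpow_neg, mul_comm F, Units.mul_inv_cancel_left] at this
  exact this

/-- Degrees only matter modulo `N` when `v ^ N ∈ G`. -/
theorem HasDegree.of_modEq (hG : ∀ u : Rˣ, (u : R) ∈ G → ((u⁻¹ : Rˣ) : R) ∈ G) {N : ℕ}
    (hv : ((v ^ N : Rˣ) : R) ∈ G) {l l' : ℤ} (hl : l ≡ l' [ZMOD N]) {F : R}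
    (h : HasDegree G v l F) : HasDegree G v l' F := by
  obtain ⟨k, hk⟩ := hl.dvd
  have h1 : HasDegree G v 0 ((v ^ N : Rˣ) : R) := hasDegree_zero_iff.2 hv
  have h2 : HasDegree G v ((N : ℤ) * k) 1 := by
    have h3 := HasDegree.zpow hG h1 (-k)
    rw [zero_mul, hasDegree_zero_iff] at h3
    unfold HasDegree
    rw [one_mul]
    convert h3 using 2
    rw [← zpow_natCast, ← zpow_mul]
    ring_nf
  have := h.mul h2
  rw [mul_one, ← hk] at this
  simpa using this

end HasDegree

/-! ### Series whose coefficients at multiples of n lie in G -/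

section TraceSubalgebra

variable {R : Type*} [CommRing R] [Algebra ℂ R] (G : Subalgebra ℂ R) (α : R⟦X⟧) (n : ℕ)

/-- The subalgebra of those power series which preserve, by multiplication, the set of all `z` such
that the coefficients of `z α^j` at the exponents divisible by `n` are in `G`. -/
def traceSubalgebra : Subalgebra ℂ R⟦X⟧ where
  carrier := {x | ∀ z : R⟦X⟧, (∀ j l, coeff (n * l) (z * α ^ j) ∈ G) →
    ∀ j l, coeff (n * l) (x * z * α ^ j) ∈ G}
  mul_mem' := by
    intro x y hx hy z hz j l
    rw [mul_assoc x y z]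
    exact hx _ (hy z hz) j l
  add_mem' := by
    intro x y hx hy z hz j l
    rw [add_mul, add_mul, map_add]
    exact G.add_mem (hx z hz j l) (hy z hz j l)
  algebraMap_mem' := by
    intro r z hz j l
    rw [← Algebra.smul_def, smul_mul_assoc]
    exact G.smul_mem (hz j l) r

variable {G α n}

/-- The hypothesis on α says that z = 1 belongs to the preserved set. Defining the algebra as a
stabiliser makes closure under products immediate. -/
theorem coeff_mem_of_mem_traceSubalgebra (hα : ∀ j l, coeff (n * l) (α ^ j) ∈ G) {x : R⟦X⟧}
    (hx : x ∈ traceSubalgebra G α n) (l : ℕ) : coeff (n * l) x ∈ G := by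
  have := hx 1 (by simpa using hα) 0 l
  simpa using this

theorem C_mem_traceSubalgebra {g : R} (hg : g ∈ G) : C g ∈ traceSubalgebra G α n := by
  intro z hz j l
  rw [mul_assoc, coeff_C_mul]
  exact G.mul_mem hg (hz j l)

theorem X_pow_mem_traceSubalgebra : (X : R⟦X⟧) ^ n ∈ traceSubalgebra G α n := by
  intro z hz j l
  rw [mul_assoc]
  cases l with
  | zero =>
    rw [coeff_X_pow_mul']
    split_ifs with h
    · have : n = 0 := by omega
      subst this
      simpa using hz j 0
    · exact G.zero_mem
  | succ l =>
    rw [Nat.mul_succ, coeff_X_pow_mul]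
    exact hz j l

theorem self_mem_traceSubalgebra : α ∈ traceSubalgebra G α n := by
  intro z hz j l
  have := hz (j + 1) l
  rwa [show α * z * α ^ j = z * α ^ (j + 1) by ring]

end TraceSubalgebra

/-! ### Inductive determination of the coefficients of α -/

section Stage

variable {R : Type*} [CommRing R] [Algebra ℂ R]

/-- The coefficients of `T^j`, `j < i`, of `α` are known up to the ring `G`: they are those of a
series in `v T^e` over `G`. -/
structure Stage (G : Subalgebra ℂ R) (α : R⟦X⟧) (n i e : ℕ) (v : Rˣ) : Prop where
  dvd : e ∣ n
  pow_mem : ((v ^ (n / e) : Rˣ) : R) ∈ G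
  coeff_deg : ∀ j < i, HasDegree G v ((j / e : ℕ) : ℤ) (coeff j α) ∧ (e ∣ j ∨ coeff j α = 0)
  separated : ∀ ε : ℂ, ε ^ n = 1 → ε ^ e ≠ 1 → ∃ o < i, ε ^ o ≠ 1 ∧ e ∣ o ∧
    IsUnit (coeff o α) ∧ ∀ j < o, coeff j α = 0 ∨ ε ^ j = 1
  exists_uniformizer : ∃ h ∈ traceSubalgebra G α n, ∃ (r : ℕ) (c : Rˣ), e * r ≡ e [MOD n] ∧
    HasLeadingTerm h (e * r) (c : R) ∧ HasDegree G v r c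

variable {G : Subalgebra ℂ R} {α : R⟦X⟧} {n i e : ℕ} {v : Rˣ}

/-- For e = n no root of unity has to be separated, and h = 1 with r = 0 serves because n · 0 ≡ n
modulo n. -/
theorem Stage.initial : Stage G α n 0 n 1 where
  dvd := dvd_rfl
  pow_mem := by simp [G.one_mem]
  coeff_deg := by simp
  separated := fun ε h h' => absurd h h'
  exists_uniformizer := ⟨1, Subalgebra.one_mem _, 0, 1, by simp [Nat.ModEq],
    by simpa using HasLeadingTerm.one, by simpa using HasDegree.one⟩

/-- `α(T)` minus the truncation of `α(εT)` below `T^i`. -/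
noncomputable def truncDiff (α : R⟦X⟧) (i : ℕ) (ε : ℂ) : R⟦X⟧ :=
  α - ∑ j ∈ Finset.range i, C (algebraMap ℂ R (ε ^ j) * coeff j α) * X ^ j

theorem coeff_truncDiff (α : R⟦X⟧) (i : ℕ) (ε : ℂ) (j : ℕ) :
    coeff j (truncDiff α i ε) =
      if j < i then algebraMap ℂ R (1 - ε ^ j) * coeff j α else coeff j α := by
  simp only [truncDiff, map_sub, map_sum, coeff_C_mul, coeff_X_pow, mul_ite, mul_one, mul_zero,
    Finset.sum_ite_eq, Finset.mem_range]
  split_ifs with h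
  · rw [map_one, sub_mul, one_mul]
  · rw [sub_zero]

theorem Stage.hasLeadingTerm_truncDiff_of_eq_one (hs : Stage G α n i e v) {ε : ℂ}
    (hε : ε ^ e = 1) : HasLeadingTerm (truncDiff α i ε) i (coeff i α) := by
  have h := HasLeadingTerm.of_coeff (z := truncDiff α i ε) (q := i) ?_
  · rwa [coeff_truncDiff, if_neg (lt_irrefl i)] at h
  · intro j hj
    rw [coeff_truncDiff, if_pos hj]
    rcases (hs.coeff_deg j hj).2 with ⟨k, rfl⟩ | h0
    · rw [pow_mul, hε, one_pow, sub_self, map_zero, zero_mul]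
    · rw [h0, mul_zero]

/-- The field `separated` supplies the first exponent at which α(T) and α(εT) differ. The
coefficient there is a unit, so these factors of the norm have invertible leading coefficients. -/
theorem Stage.hasLeadingTerm_truncDiff_of_ne_one (hs : Stage G α n i e v) {ε : ℂ}
    (hn : ε ^ n = 1) (hε : ε ^ e ≠ 1) : ∃ (q : ℕ) (c : Rˣ),
      HasLeadingTerm (truncDiff α i ε) (e * q) (c : R) ∧ HasDegree G v q c := by
  obtain ⟨o, hoi, hεo, ⟨q, rfl⟩, hu, hlt⟩ := hs.separated ε hn hε
  have h := HasLeadingTerm.of_coeff (z := truncDiff α i ε) (q := e * q) ?_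
  · rw [coeff_truncDiff, if_pos hoi] at h
    have hu' : IsUnit (algebraMap ℂ R (1 - ε ^ (e * q)) * coeff (e * q) α) :=
      ((isUnit_iff_ne_zero.2 (sub_ne_zero.2 (Ne.symm hεo))).map _).mul hu
    refine ⟨q, hu'.unit, h, ?_⟩
    have he : 0 < e := Nat.pos_of_ne_zero fun h0 => hεo (by simp [h0])
    have := (hs.coeff_deg _ hoi).1
    rw [Nat.mul_div_cancel_left _ he] at this
    exact this.algebraMap_mul _
  · intro j hj
    rw [coeff_truncDiff, if_pos (hj.trans hoi)]
    rcases hlt j hj with h0 | h1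
    · rw [h0, mul_zero]
    · rw [h1, sub_self, map_zero, zero_mul]

/-- The value at `α` of the minimal polynomial of the truncation of `α` below `T^i`. -/
theorem Stage.exists_mem_hasLeadingTerm (hn : 0 < n) (hs : Stage G α n i e v) :
    ∃ β ∈ traceSubalgebra G α n, ∃ (N : ℕ) (c : Rˣ),
      HasLeadingTerm β (i + e * N) (c * coeff i α) ∧ HasDegree G v N c := by
  classical
  have he : 0 < e := Nat.pos_of_dvd_of_pos hs.dvd hn
  have hNe : 0 < n / e := Nat.div_pos (Nat.le_of_dvd hn hs.dvd) he
  have hne : e * (n / e) = n := Nat.mul_div_cancel' hs.dvd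
  set L := traceSubalgebra G α n
  have hdeg : ∀ j : Finset.range i,
      C (coeff (j : ℕ) α * ((v ^ (-(((j : ℕ) / e : ℕ) : ℤ)) : Rˣ) : R)) ∈ L := fun j =>
    C_mem_traceSubalgebra (hs.coeff_deg j (Finset.mem_range.1 j.2)).1
  -- This is α − Σ g_j Y^(j/e) with α a constant from `L`; its values at ω v T^e are the factors of
  -- the norm.
  set P : Polynomial L := Polynomial.C ⟨α, self_mem_traceSubalgebra⟩ -
    ∑ j : Finset.range i, Polynomial.C ⟨_, hdeg j⟩ * Polynomial.X ^ ((j : ℕ) / e) with hP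
  set z : R⟦X⟧ := C (v : R) * X ^ e with hz
  have hzL : z ^ (n / e) ∈ L := by
    rw [hz, mul_pow, ← pow_mul, hne, ← map_pow]
    exact L.mul_mem (C_mem_traceSubalgebra (by simpa using hs.pow_mem)) X_pow_mem_traceSubalgebra
  have hPz : ∀ ε : ℂ, Polynomial.aeval (ε ^ e • z) P = truncDiff α i ε := by
    intro ε
    rw [hP, truncDiff, Polynomial.aeval_sub, map_sum, Polynomial.aeval_C,
      ← Finset.sum_coe_sort (Finset.range i)]
    congr 1
    have key : ∀ m : ℕ, (e ∣ m ∨ coeff m α = 0) →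
        C (coeff m α * ((v ^ (-((m / e : ℕ) : ℤ)) : Rˣ) : R)) * (ε ^ e • z) ^ (m / e) =
          C (algebraMap ℂ R (ε ^ m) * coeff m α) * X ^ m := by
      rintro m (⟨k, rfl⟩ | h0)
      · rw [Nat.mul_div_cancel_left _ he, hz, Algebra.smul_def, mul_pow, mul_pow, ← map_pow,
          ← pow_mul, ← pow_mul, ← map_pow, PowerSeries.algebraMap_apply, ← mul_assoc, ← mul_assoc,
          ← map_mul, ← map_mul]
        congr 2
        calc _ = algebraMap ℂ R (ε ^ (e * k)) * coeff (e * k) α *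
            ((v ^ (-(k : ℤ)) : Rˣ) * (v : R) ^ k) := by ring
          _ = _ := by
            rw [zpow_neg, zpow_natCast, ← Units.val_pow_eq_pow_val, Units.inv_mul, mul_one]
      · rw [h0]
        simp
    refine Finset.sum_congr rfl fun j _ => ?_
    rw [map_mul, Polynomial.aeval_C, map_pow, Polynomial.aeval_X]
    exact key j (hs.coeff_deg j (Finset.mem_range.1 j.2)).2
  -- Writing ω = ε^e turns the factor at ω into the difference of α(T) and the truncated α(εT).
  have hroot : ∀ ω ∈ Polynomial.nthRootsFinset (n / e) (1 : ℂ), ∃ ε : ℂ, ε ^ e = ω ∧ ε ^ n = 1 := by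
    intro ω hω
    obtain ⟨ε, hε⟩ := IsAlgClosed.exists_pow_nat_eq ω he
    rw [Polynomial.mem_nthRootsFinset hNe] at hω
    exact ⟨ε, hε, by rw [← hne, pow_mul, hε, hω]⟩
  refine ⟨_, prod_aeval_smul_mem L P hNe z hzL, ?_⟩
  have h1 : (1 : ℂ) ∈ Polynomial.nthRootsFinset (n / e) (1 : ℂ) :=
    Polynomial.one_mem_nthRootsFinset hNe
  -- The factors with ω ≠ 1 contribute the unit c; the factor ω = 1 contributes a_i T^i.
  have hprod : ∀ T : Finset ℂ, T ⊆ (Polynomial.nthRootsFinset (n / e) (1 : ℂ)).erase 1 →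
      ∃ (N : ℕ) (c : Rˣ), HasLeadingTerm (∏ ω ∈ T, Polynomial.aeval (ω • z) P) (e * N) (c : R) ∧
        HasDegree G v N c := by
    intro T
    induction T using Finset.induction_on with
    | empty => intro _; exact ⟨0, 1, by simpa using HasLeadingTerm.one, by simpa using HasDegree.one⟩
    | insert ω T hωT ih =>
      intro hsub
      obtain ⟨N, c, hN, hc⟩ := ih ((Finset.subset_insert _ _).trans hsub)
      have hω := hsub (Finset.mem_insert_self _ _)
      obtain ⟨ε, rfl, hεn⟩ := hroot ω (Finset.mem_of_mem_erase hω)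
      obtain ⟨q, c', hq, hc'⟩ :=
        hs.hasLeadingTerm_truncDiff_of_ne_one hεn (Finset.ne_of_mem_erase hω)
      refine ⟨q + N, c' * c, ?_, ?_⟩
      · rw [Finset.prod_insert hωT, hPz, mul_add]
        simpa using hq.mul hN
      · simpa using hc'.mul hc
  obtain ⟨N, c, hN, hc⟩ := hprod _ subset_rfl
  refine ⟨N, c, ?_, hc⟩
  rw [← Finset.mul_prod_erase _ _ h1]
  have h := hPz 1
  rw [one_pow] at h
  rw [h, mul_comm (c : R)]
  exact (hs.hasLeadingTerm_truncDiff_of_eq_one (one_pow e)).mul hN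

variable (hG : ∀ u : Rˣ, (u : R) ∈ G → ((u⁻¹ : Rˣ) : R) ∈ G)
  (hα : ∀ j l, coeff (n * l) (α ^ j) ∈ G)

include hG hα in
-- A product β^k h^p, with β the norm value and h the uniformizer, is arranged to have leading
-- exponent divisible by n. Its leading coefficient, a_i^k times a unit of known degree, then lies
-- in G. The case k = 1 serves when e ∣ i, and k = e / gcd(e, i) when i is a characteristic
-- exponent.
theorem Stage.hasDegree_pow_coeff (hn : 0 < n) (hs : Stage G α n i e v) {k l : ℕ}
    (hk : i * k = e * l) : HasDegree G v l (coeff i α ^ k) := by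
  have he : 0 < e := Nat.pos_of_dvd_of_pos hs.dvd hn
  have hNe : 0 < n / e := Nat.div_pos (Nat.le_of_dvd hn hs.dvd) he
  have hne : e * (n / e) = n := Nat.mul_div_cancel' hs.dvd
  obtain ⟨β, hβL, N, c, hβ, hc⟩ := hs.exists_mem_hasLeadingTerm hn
  obtain ⟨h, hL, r, d, hr, hh, hd⟩ := hs.exists_uniformizer
  -- The leading exponent of β^k is e q. As r ≡ 1 modulo n/e, the choice of p gives q + r p ≡ (n/e)
  -- q ≡ 0, so e (q + r p) is a multiple of n.
  set q := l + N * k with hq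
  set p := (n / e - 1) * q with hp
  have hmod : q + r * p ≡ 0 [MOD n / e] := by
    have h1 : r ≡ 1 [MOD n / e] := by
      have : e * r ≡ e * 1 [MOD e * (n / e)] := by rwa [hne, mul_one]
      exact Nat.ModEq.mul_left_cancel' he.ne' this
    have h2 : q + r * p ≡ q + 1 * p [MOD n / e] := (h1.mul_right p).add_left q
    have h3 : q + 1 * p = (n / e) * q := by
      rw [hp, one_mul]
      obtain ⟨a, ha⟩ : ∃ a, n / e = a + 1 := ⟨n / e - 1, by omega⟩
      rw [ha, Nat.add_sub_cancel]; ring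
    rw [h3] at h2
    exact h2.trans (by simp [Nat.ModEq])
  obtain ⟨t, ht⟩ := (Nat.modEq_zero_iff_dvd.1 hmod)
  have hlead := (hβ.pow k).mul (hh.pow p)
  have hexp : (i + e * N) * k + e * r * p = n * t := by
    calc (i + e * N) * k + e * r * p = i * k + e * (N * k) + e * (r * p) := by ring
      _ = e * (q + r * p) := by rw [hk, hq]; ring
      _ = n * t := by rw [ht, ← mul_assoc, hne]
  have hmem := coeff_mem_of_mem_traceSubalgebra hα
    (Subalgebra.mul_mem _ (Subalgebra.pow_mem _ hβL k) (Subalgebra.pow_mem _ hL p)) t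
  rw [← hexp, hlead.coeff] at hmem
  have h0 : HasDegree G v 0 (((c ^ k * d ^ p : Rˣ) : R) * coeff i α ^ k) := by
    rw [hasDegree_zero_iff]
    convert hmem using 1
    push_cast
    ring
  have hcd : HasDegree G v (N * k + r * p) ((c ^ k * d ^ p : Rˣ) : R) := by
    simpa using (hc.pow k).mul (hd.pow p)
  refine HasDegree.of_modEq hG hs.pow_mem ?_ (HasDegree.of_unit_mul hG hcd h0)
  refine (Int.modEq_iff_dvd.2 ⟨t, ?_⟩)
  have : ((q + r * p : ℕ) : ℤ) = ((n / e * t : ℕ) : ℤ) := by rw [ht]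
  rw [hq] at this
  push_cast at this ⊢
  linarith

include hG hα in
theorem Stage.succ_of_dvd (hn : 0 < n) (hs : Stage G α n i e v) (h : e ∣ i ∨ coeff i α = 0) :
    Stage G α n (i + 1) e v where
  dvd := hs.dvd
  pow_mem := hs.pow_mem
  coeff_deg := by
    intro j hj
    rcases Nat.lt_succ_iff_lt_or_eq.1 hj with hj | rfl
    · exact hs.coeff_deg j hj
    · refine ⟨?_, h⟩
      rcases h with h | h
      · have := hs.hasDegree_pow_coeff hG hα hn (k := 1) (l := j / e)
          (by rw [mul_one, Nat.mul_div_cancel' h])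
        rwa [pow_one] at this
      · rw [h]; exact HasDegree.zero _
  separated := by
    intro ε h1 h2
    obtain ⟨o, ho, h⟩ := hs.separated ε h1 h2
    exact ⟨o, ho.trans i.lt_succ_self, h⟩
  exists_uniformizer := hs.exists_uniformizer

include hG hα in
-- Let e' = gcd(e, i), k = e/e', i' = i/e', and let A be the coefficient a_i. Then A^k v^(-i') is a
-- unit lying in G. With kx + i'y = 1 and v' = v^x A^y, both v v'^(-k) and A v'^(-i') are powers of
-- that unit, so v and A have degrees k and i' with respect to v'.
theorem Stage.succ_of_isUnit (hn : 0 < n) (hs : Stage G α n i e v) (h : IsUnit (coeff i α)) :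
    ∃ v' : Rˣ, Stage G α n (i + 1) (e.gcd i) v' := by
  have he : 0 < e := Nat.pos_of_dvd_of_pos hs.dvd hn
  have hne : e * (n / e) = n := Nat.mul_div_cancel' hs.dvd
  obtain ⟨A, hA⟩ := h
  set e' := e.gcd i with he'
  have he'0 : 0 < e' := Nat.gcd_pos_of_pos_left _ he
  obtain ⟨k, hk⟩ : e' ∣ e := Nat.gcd_dvd_left _ _
  obtain ⟨i', hi'⟩ : e' ∣ i := Nat.gcd_dvd_right _ _
  set x := e.gcdA i
  set y := e.gcdB i
  have hxy : (e' : ℤ) = e * x + i * y := Nat.gcd_eq_gcd_ab e i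
  have hxy' : (k : ℤ) * x + i' * y = 1 := by
    have : (e' : ℤ) * (k * x + i' * y) = e' * 1 := by
      calc (e' : ℤ) * (k * x + i' * y)
          = ((e' * k : ℕ) : ℤ) * x + ((e' * i' : ℕ) : ℤ) * y := by push_cast; ring
      _ = e' * 1 := by rw [← hk, ← hi', mul_one, hxy]
    exact mul_left_cancel₀ (by exact_mod_cast he'0.ne') this
  have hAk : HasDegree G v i' ((A : R) ^ k) := by
    rw [hA]
    exact hs.hasDegree_pow_coeff hG hα hn (by rw [hi', hk]; ring)
  have hAk' : ((A ^ k * v ^ (-(i' : ℤ)) : Rˣ) : R) ∈ G := by simpa [HasDegree] using hAk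
  have hzp : ∀ (u : Rˣ) (z : ℤ), (u : R) ∈ G → ((u ^ z : Rˣ) : R) ∈ G := fun u z hu => by
    simpa [hasDegree_zero_iff] using
      HasDegree.zpow (v := 1) hG (hasDegree_zero_iff.2 hu : HasDegree G 1 0 (u : R)) z
  set v' : Rˣ := v ^ x * A ^ y with hv'
  have hvdeg : HasDegree G v' k (v : R) := by
    have h1 := hzp _ (-y) hAk'
    have h2 : v * v' ^ (-(k : ℤ)) = (A ^ k * v ^ (-(i' : ℤ))) ^ (-y) := by
      rw [hv', mul_zpow, mul_zpow, ← zpow_natCast A k, ← zpow_mul, ← zpow_mul, ← zpow_mul,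
        ← zpow_mul, ← mul_assoc, ← zpow_one_add, mul_comm]
      congr 2
      · ring
      · linear_combination -hxy'
    unfold HasDegree
    rw [← Units.val_mul, h2]
    exact h1
  have hAdeg : HasDegree G v' i' (A : R) := by
    have h1 := hzp _ x hAk'
    have h2 : A * v' ^ (-(i' : ℤ)) = (A ^ k * v ^ (-(i' : ℤ))) ^ x := by
      rw [hv', mul_zpow, mul_zpow, ← zpow_natCast A k, ← zpow_mul, ← zpow_mul, ← zpow_mul,
        ← zpow_mul, mul_left_comm, ← zpow_one_add, mul_comm]
      congr 2
      · linear_combination -hxy'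
      · ring
    unfold HasDegree
    rw [← Units.val_mul, h2]
    exact h1
  have hdvd : e' ∣ n := (Dvd.intro _ hk.symm).trans hs.dvd
  refine ⟨v', hdvd, ?_, ?_, ?_, ?_⟩
  -- Since v^(n/e) ∈ G while v has degree k, the element 1 has degree k (n/e) = n/e' with respect to
  -- v'; hence v'^(n/e') ∈ G.
  · have h1 : HasDegree G v' (k * (n / e : ℕ)) 1 := by
      have h2 := HasDegree.change hG hvdeg (hasDegree_zero_iff.2 (hG _ hs.pow_mem))
      have h3 := (hvdeg.pow (n / e)).mul h2
      rwa [mul_zero, add_zero, ← Units.val_pow_eq_pow_val, Units.mul_inv] at h3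
    have h4 : k * (n / e) = n / e' := by
      refine (Nat.div_eq_of_eq_mul_right he'0 ?_).symm
      rw [← mul_assoc, ← hk, hne]
    unfold HasDegree at h1
    rw [one_mul] at h1
    have h5 := hG _ h1
    rw [← zpow_neg, neg_neg, ← Nat.cast_mul, h4, zpow_natCast] at h5
    exact h5
  · intro j hj
    rcases Nat.lt_succ_iff_lt_or_eq.1 hj with hj | rfl
    · obtain ⟨h1, h2⟩ := hs.coeff_deg j hj
      rcases h2 with ⟨t, rfl⟩ | h0
      · refine ⟨?_, Or.inl ⟨k * t, by rw [hk]; ring⟩⟩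
        rw [Nat.mul_div_cancel_left _ he] at h1
        have := HasDegree.change hG hvdeg h1
        rwa [hk, mul_assoc, Nat.mul_div_cancel_left _ he'0, Nat.cast_mul, ← mul_assoc, ← hk]
      · rw [h0]
        exact ⟨HasDegree.zero _, Or.inr rfl⟩
    · refine ⟨?_, Or.inl ⟨i', hi'⟩⟩
      rw [← hA]
      convert hAdeg using 2
      exact Nat.div_eq_of_eq_mul_right he'0 hi'
  · intro ε hεn hε
    -- Roots of unity separated before keep their exponent; those with ε^e = 1 but ε^e' ≠ 1 are
    -- separated by i itself.
    by_cases hεe : ε ^ e = 1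
    · refine ⟨i, i.lt_succ_self, fun hεi => hε ?_, ⟨i', hi'⟩, ⟨A, hA⟩, fun j hj => ?_⟩
      · exact orderOf_dvd_iff_pow_eq_one.1
          (Nat.dvd_gcd (orderOf_dvd_of_pow_eq_one hεe) (orderOf_dvd_of_pow_eq_one hεi))
      · rcases (hs.coeff_deg j hj).2 with ⟨t, rfl⟩ | h0
        · right; rw [pow_mul, hεe, one_pow]
        · exact Or.inl h0
    · obtain ⟨o, ho, h1, h2, h3⟩ := hs.separated ε hεn hεe
      exact ⟨o, ho.trans i.lt_succ_self, h1, (Dvd.intro _ hk.symm).trans h2, h3⟩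
  · obtain ⟨β, hβL, N, c, hβ, hc⟩ := hs.exists_mem_hasLeadingTerm hn
    obtain ⟨h, hL, r, d, hr, hh, hd⟩ := hs.exists_uniformizer
    -- The Bézout coefficients are replaced by nonnegative residues modulo n. Subtracting N y' from
    -- x cancels the extra e N in the leading exponent i + e N of β, so h^x' β^y' has leading
    -- exponent ≡ e x + i y = e'.
    have hn' : (n : ℤ) ≠ 0 := by exact_mod_cast hn.ne'
    obtain ⟨y', hy'⟩ := Int.eq_ofNat_of_zero_le (Int.emod_nonneg y hn')
    obtain ⟨x', hx'⟩ := Int.eq_ofNat_of_zero_le (Int.emod_nonneg (x - N * y') hn')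
    have hymod : (y' : ℤ) ≡ y [ZMOD n] := by rw [← hy']; exact Int.mod_modEq _ _
    have hxmod : (x' : ℤ) ≡ x - N * y' [ZMOD n] := by rw [← hx']; exact Int.mod_modEq _ _
    refine ⟨h ^ x' * β ^ y', Subalgebra.mul_mem _ (Subalgebra.pow_mem _ hL _)
      (Subalgebra.pow_mem _ hβL _), k * (r * x') + (i' + k * N) * y', d ^ x' * (c * A) ^ y',
      ?_, ?_, ?_⟩
    · rw [← Int.natCast_modEq_iff]
      have hr' : ((e * r : ℕ) : ℤ) ≡ e [ZMOD n] := Int.natCast_modEq_iff.2 hr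
      have e1 : ((e' * (k * (r * x') + (i' + k * N) * y') : ℕ) : ℤ) =
          ((e * r : ℕ) : ℤ) * x' + (i + e * N) * y' := by
        nth_rewrite 2 [hk]; nth_rewrite 1 [hi']; nth_rewrite 1 [hk]
        push_cast; ring
      rw [e1]
      calc ((e * r : ℕ) : ℤ) * x' + (i + e * N) * y'
          ≡ e * (x - N * y') + (i + e * N) * y' [ZMOD n] := (hr'.mul hxmod).add_right _
        _ = e * x + i * y' := by ring
        _ ≡ e * x + i * y [ZMOD n] := (hymod.mul_left _).add_left _
        _ = e' := hxy.symm
    · have := (hh.pow x').mul (hβ.pow y')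
      rw [← hA] at this
      convert this using 1
      · calc _ = e' * k * r * x' + (e' * i' + e' * k * N) * y' := by ring
          _ = _ := by rw [← hk, ← hi']
      · push_cast; ring
    · have h1 := (HasDegree.change hG hvdeg hd).pow x'
      have h2 := ((HasDegree.change hG hvdeg hc).mul hAdeg).pow y'
      have h3 := h1.mul h2
      push_cast
      convert h3 using 1
      ring

end Stage

/-! ### Weierstrass division over an arbitrary coefficient ring -/

section WeierstrassDivision

theorem mem_span_range_X {A : Type*} [CommRing A] {a : MvPowerSeries (Fin 1) A}
    (h : MvPowerSeries.constantCoeff a = 0) :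
    a ∈ Ideal.span (Set.range (MvPowerSeries.X : Fin 1 → MvPowerSeries (Fin 1) A)) := by
  have hdvd : (MvPowerSeries.X 0 : MvPowerSeries (Fin 1) A) ∣ a := by
    rw [MvPowerSeries.X_dvd_iff]
    intro m hm
    have : m = 0 := by
      refine Finsupp.ext fun i => ?_
      rw [Subsingleton.elim i 0, hm]
      rfl
    rw [this]
    exact h
  exact Ideal.mem_of_dvd _ hdvd (Ideal.subset_span ⟨0, rfl⟩)

theorem span_range_X_ne_top (A : Type*) [CommRing A] [Nontrivial A] :
    Ideal.span (Set.range (MvPowerSeries.X : Fin 1 → MvPowerSeries (Fin 1) A)) ≠ ⊤ := by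
  intro h
  have hle : Ideal.span (Set.range (MvPowerSeries.X : Fin 1 → MvPowerSeries (Fin 1) A)) ≤
      RingHom.ker (MvPowerSeries.constantCoeff (σ := Fin 1) (R := A)) := by
    rw [Ideal.span_le]
    rintro _ ⟨i, rfl⟩
    simp
  rw [h] at hle
  have := hle (Submodule.mem_top (x := (1 : MvPowerSeries (Fin 1) A)))
  rw [RingHom.mem_ker, map_one] at this
  exact one_ne_zero this

/-- Power series in `X` and `Y` as power series in `Y` over the power series in `X`. -/
noncomputable def seriesInY (A : Type*) [CommRing A] :
    MvPowerSeries (Fin 2) A ≃ₐ[A] PowerSeries (MvPowerSeries (Fin 1) A) :=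
  -- `MvPowerSeries.finSuccEquiv` splits off the variable of index 0, so X and Y are exchanged
  -- first.
  (MvPowerSeries.renameEquiv A (Equiv.swap 0 1)).trans (MvPowerSeries.finSuccEquiv A 1)

theorem coeff_coeff_seriesInY {A : Type*} [CommRing A] (F : MvPowerSeries (Fin 2) A) (i j : ℕ) :
    MvPowerSeries.coeff (Finsupp.single 0 i) (PowerSeries.coeff j (seriesInY A F)) =
      MvPowerSeries.coeff (Finsupp.single 0 i + Finsupp.single 1 j) F := by
  have h := MvPowerSeries.coeff_embDomain_rename (Equiv.swap (0 : Fin 2) 1).toEmbedding F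
    (Finsupp.single 0 i + Finsupp.single 1 j)
  rw [← h]
  change MvPowerSeries.coeff _ (PowerSeries.coeff j (MvPowerSeries.finSuccEquiv A 1
    (MvPowerSeries.rename (Equiv.swap (0 : Fin 2) 1) F))) = _
  rw [MvPowerSeries.coeff_coeff_finSuccEquiv]
  congr 2
  rw [Finsupp.embDomain_eq_mapDomain, Finsupp.mapDomain_add, Finsupp.mapDomain_single,
    Finsupp.mapDomain_single]
  ext a
  fin_cases a <;> simp
  exact (Finsupp.cons_succ 0 j (Finsupp.single (0 : Fin 1) i)).trans Finsupp.single_eq_same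

/-- Weierstrass division of `Y^n` by a series of order `n` in `Y`, over an arbitrary ring. -/
theorem exists_weierstrass_division {A : Type*} [CommRing A] (F : MvPowerSeries (Fin 2) A) (n : ℕ)
    (h0 : ∀ j < n, MvPowerSeries.coeff (Finsupp.single 0 0 + Finsupp.single 1 j) F = 0)
    (hn : IsUnit (MvPowerSeries.coeff (Finsupp.single 0 0 + Finsupp.single 1 n) F)) :
    ∃ q r : MvPowerSeries (Fin 2) A, MvPowerSeries.X 1 ^ n = F * q + r ∧
      ∀ i j, n ≤ j → MvPowerSeries.coeff (Finsupp.single 0 i + Finsupp.single 1 j) r = 0 := by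
  rcases subsingleton_or_nontrivial A with hA | hA
  · exact ⟨0, 0, MvPowerSeries.ext fun _ => Subsingleton.elim _ _, fun _ _ _ => by simp⟩
  -- A[[X]] is complete for the ideal (X) whatever the ring A. Division in Y thus only needs F to
  -- have order n modulo X, with a unit as coefficient of Y^n.
  set I := Ideal.span (Set.range (MvPowerSeries.X : Fin 1 → MvPowerSeries (Fin 1) A)) with hI
  have hItop : I ≠ ⊤ := span_range_X_ne_top A
  have hcc : ∀ j, MvPowerSeries.constantCoeff (PowerSeries.coeff j (seriesInY A F)) =
      MvPowerSeries.coeff (Finsupp.single 0 0 + Finsupp.single 1 j) F := by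
    intro j
    rw [← coeff_coeff_seriesInY, Finsupp.single_zero, MvPowerSeries.coeff_zero_eq_constantCoeff]
  have hu : IsUnit (PowerSeries.coeff n (seriesInY A F)) := by
    rw [MvPowerSeries.isUnit_iff_constantCoeff, hcc]
    exact hn
  have horder : ((seriesInY A F).map (Ideal.Quotient.mk I)).order = n := by
    rw [PowerSeries.order_eq_nat]
    have := Ideal.Quotient.nontrivial_iff.2 hItop
    refine ⟨?_, fun j hj => ?_⟩
    · rw [PowerSeries.coeff_map]
      exact (hu.map _).ne_zero
    · rw [PowerSeries.coeff_map, Ideal.Quotient.eq_zero_iff_mem]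
      exact mem_span_range_X (by rw [hcc, h0 j hj])
  have hdiv : (seriesInY A F).IsWeierstrassDivisorAt I := by
    unfold PowerSeries.IsWeierstrassDivisorAt
    rw [horder]
    exact hu
  have H := hdiv.isWeierstrassDivisionAt_div_mod (seriesInY A (MvPowerSeries.X 1 ^ n))
  refine ⟨(seriesInY A).symm (hdiv.div (seriesInY A (MvPowerSeries.X 1 ^ n))),
    (seriesInY A).symm (hdiv.mod (seriesInY A (MvPowerSeries.X 1 ^ n)) : Polynomial _), ?_, ?_⟩
  · apply (seriesInY A).injective
    rw [map_add, map_mul, AlgEquiv.apply_symm_apply, AlgEquiv.apply_symm_apply]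
    exact H.eq_mul_add
  · intro i j hj
    rw [← coeff_coeff_seriesInY, AlgEquiv.apply_symm_apply, Polynomial.coeff_coe,
      Polynomial.coeff_eq_zero_of_degree_lt, map_zero]
    refine H.degree_lt.trans_le ?_
    rw [horder]
    exact_mod_cast hj

end WeierstrassDivision

/-! ### Substitution of (T^n, α) and the monic equation of α -/

section Subst

/-- `g(T^n)`. -/
def expandSeries {A : Type*} [CommRing A] (n : ℕ) (g : ℕ → A) : A⟦X⟧ :=
  PowerSeries.mk fun l => if n ∣ l then g (l / n) else 0

/-- `g(X)` as a power series in `X` and `Y`. -/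
def seriesInX (g : ℕ → ℂ) : Series2 := fun d => if d 1 = 0 then g (d 0) else 0

theorem coeff_seriesInX (g : ℕ → ℂ) (d : Fin 2 →₀ ℕ) :
    MvPowerSeries.coeff d (seriesInX g) = if d 1 = 0 then g (d 0) else 0 := rfl

variable {n : ℕ} {α : PowerSeries ℂ}

theorem hasSubst_pair (hn : 0 < n) (hα : constantCoeff α = 0) :
    MvPowerSeries.HasSubst (![PowerSeries.X ^ n, α] : Fin 2 → PowerSeries ℂ) := by
  refine MvPowerSeries.hasSubst_of_constantCoeff_zero fun s => ?_
  fin_cases s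
  · change PowerSeries.constantCoeff ((PowerSeries.X : PowerSeries ℂ) ^ n) = 0
    simp [hn.ne']
  · exact hα

theorem substPair_series_X (hn : 0 < n) (hα : constantCoeff α = 0) (g : ℕ → ℂ) :
    substPair n α (seriesInX g) = expandSeries n g := by
  ext l
  have h := MvPowerSeries.coeff_subst (hasSubst_pair hn hα)
    (seriesInX g) (Finsupp.single () l)
  refine h.trans ?_
  rw [finsum_eq_single _ (Finsupp.single 0 (l / n))]
  · rw [Finsupp.prod_fintype _ _ (fun _ => pow_zero _), Fin.prod_univ_two, expandSeries, coeff_mk]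
    change (if _ then _ else _) • PowerSeries.coeff l (((X : PowerSeries ℂ) ^ n) ^ _ * α ^ _) = _
    simp only [Finsupp.single_eq_same, Finsupp.single_apply, Fin.isValue, zero_ne_one, if_false,
      if_true, pow_zero, mul_one, ← pow_mul, coeff_X_pow, smul_eq_mul, mul_ite, mul_zero]
    congr 1
    rw [eq_iff_iff]
    exact ⟨fun h => ⟨_, h⟩, fun h => (Nat.mul_div_cancel' h).symm⟩
  · intro d hd
    rw [Finsupp.prod_fintype _ _ (fun _ => pow_zero _), Fin.prod_univ_two]
    change (if d 1 = 0 then g (d 0) else 0) •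
      PowerSeries.coeff l (((X : PowerSeries ℂ) ^ n) ^ (d 0) * α ^ (d 1)) = 0
    split_ifs with h1
    · rw [h1, pow_zero, mul_one, ← pow_mul, coeff_X_pow, if_neg, smul_zero]
      rintro rfl
      apply hd
      ext a
      fin_cases a
      · simp [Nat.mul_div_cancel_left _ hn]
      · simpa using h1
    · rw [zero_smul]

/-- Being a finite sum, this decomposition reduces the substitution in r to that in series of X
alone. -/
theorem series_eq_sum {r : Series2} (hr : ∀ i j, n ≤ j → coeffXY r i j = 0) :
    r = ∑ k ∈ Finset.range n, MvPowerSeries.X 1 ^ k *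
      seriesInX (fun i => coeffXY r i k) := by
  classical
  have hd : ∀ d : Fin 2 →₀ ℕ, MvPowerSeries.coeff d r = coeffXY r (d 0) (d 1) := by
    intro d
    unfold coeffXY
    congr 2
    ext a
    fin_cases a <;> simp
  ext d
  rw [map_sum]
  have hk : ∀ k, MvPowerSeries.coeff d (MvPowerSeries.X 1 ^ k *
      seriesInX (fun i => coeffXY r i k)) =
      if k = d 1 then coeffXY r (d 0) (d 1) else 0 := by
    intro k
    rw [MvPowerSeries.X_pow_eq, MvPowerSeries.coeff_monomial_mul, one_mul]
    simp only [Finsupp.single_le_iff, coeff_seriesInX, Finsupp.tsub_apply, Finsupp.single_apply]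
    rcases lt_trichotomy k (d 1) with h | h | h
    · rw [if_pos h.le, if_neg (by simp; omega), if_neg h.ne]
    · simp [h]
    · rw [if_neg h.not_ge, if_neg h.ne']
  simp only [hk, Finset.sum_ite_eq', Finset.mem_range]
  rw [hd]
  split_ifs with h
  · rfl
  · exact hr _ _ (not_lt.1 h)

theorem substPair_polynomial (hn : 0 < n) (hα : constantCoeff α = 0) {r : Series2}
    (hr : ∀ i j, n ≤ j → coeffXY r i j = 0) :
    substPair n α r =
      ∑ k ∈ Finset.range n, expandSeries n (fun i => coeffXY r i k) * α ^ k := by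
  conv_lhs => rw [series_eq_sum hr]
  unfold substPair
  rw [← MvPowerSeries.substAlgHom_apply (hasSubst_pair hn hα), map_sum]
  refine Finset.sum_congr rfl fun k _ => ?_
  rw [map_mul, map_pow, MvPowerSeries.substAlgHom_X, MvPowerSeries.substAlgHom_apply]
  have := substPair_series_X hn hα (fun i => coeffXY r i k)
  unfold substPair at this
  rw [this, mul_comm]
  rfl

/-- A monic relation of degree `n` for the roots of `f(T^n, Y) = 0`, with coefficients depending on
`f` through elements of the ring `G` of functions. -/
theorem exists_monic_relation {ι : Type*} {G : Subalgebra ℂ (ι → ℂ)}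
    (hG : ∀ u : (ι → ℂ)ˣ, (u : ι → ℂ) ∈ G → ((u⁻¹ : (ι → ℂ)ˣ) : ι → ℂ) ∈ G) {f : ι → Series2}
    (hf : ∀ i j, (fun p => coeffXY (f p) i j) ∈ G) (hn : 0 < n)
    (h0 : ∀ p, ∀ j < n, coeffXY (f p) 0 j = 0) (h1 : ∀ p, coeffXY (f p) 0 n ≠ 0) :
    ∃ g : ℕ → ℕ → G, ∀ p, ∀ α : PowerSeries ℂ, constantCoeff α = 0 → substPair n α (f p) = 0 →
      α ^ n = ∑ k ∈ Finset.range n, expandSeries n (fun i => (g k i : ι → ℂ) p) * α ^ k := by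
  -- All the series f_p are assembled into one series over G, so that a single division serves every
  -- p.
  set F : MvPowerSeries (Fin 2) G := fun d => ⟨_, hf (d 0) (d 1)⟩ with hF
  have hFc : ∀ i j, MvPowerSeries.coeff (Finsupp.single 0 i + Finsupp.single 1 j) F =
      ⟨_, hf i j⟩ := by
    intro i j
    change F _ = _
    simp [hF]
  have hu : IsUnit (MvPowerSeries.coeff (Finsupp.single 0 0 + Finsupp.single 1 n) F) := by
    rw [hFc]
    have hu : IsUnit (fun p => coeffXY (f p) 0 n) :=
      Pi.isUnit_iff.2 fun p => isUnit_iff_ne_zero.2 (h1 p)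
    obtain ⟨u, hu⟩ := hu
    have hinv := hG u (hu ▸ hf 0 n)
    refine IsUnit.of_mul_eq_one ⟨_, hinv⟩ (Subtype.ext ?_)
    change (fun p => coeffXY (f p) 0 n) * _ = 1
    rw [← hu, Units.mul_inv]
  obtain ⟨q, r, hqr, hr⟩ := exists_weierstrass_division F n
    (fun j hj => by rw [hFc]; exact Subtype.ext (funext fun p => h0 p j hj)) hu
  refine ⟨fun k i => MvPowerSeries.coeff (Finsupp.single 0 i + Finsupp.single 1 k) r, ?_⟩
  intro p α hα hfα
  set ev : G →+* ℂ := (Pi.evalRingHom (fun _ : ι => ℂ) p).comp G.val.toRingHom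
  have hFp : MvPowerSeries.map ev F = f p := by
    ext d
    rw [MvPowerSeries.coeff_map]
    change coeffXY (f p) (d 0) (d 1) = _
    unfold coeffXY
    congr 2
    ext a
    fin_cases a <;> simp
  -- Specialised at p and substituted, the division Y^n = F q + r loses the term F q, because
  -- f_p(T^n, α) = 0.
  have hrel := congrArg (fun z => substPair n α (MvPowerSeries.map ev z)) hqr
  simp only [map_pow, map_add, map_mul, MvPowerSeries.map_X, hFp] at hrel
  unfold substPair at hrel hfα
  rw [MvPowerSeries.subst_pow (hasSubst_pair hn hα), MvPowerSeries.subst_X (hasSubst_pair hn hα),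
    MvPowerSeries.subst_add (hasSubst_pair hn hα), MvPowerSeries.subst_mul (hasSubst_pair hn hα),
    hfα, zero_mul, zero_add] at hrel
  have h2 := substPair_polynomial hn hα (r := MvPowerSeries.map ev r) (fun i j hj => by
    unfold coeffXY
    rw [MvPowerSeries.coeff_map, hr i j hj, map_zero])
  exact hrel.trans h2

end Subst

/-! ### Conjugates and Newton's identities -/

section PowerSums

/-- Newton's identities in existential form: the power sums of the roots of a monic polynomial are
universal polynomials in its coefficients. -/
theorem exists_powerSum_polynomial (n j : ℕ) : ∃ P : MvPolynomial (Fin n) ℂ,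
    ∀ (S : Type) [CommRing S] [Algebra ℂ S] (σ : Type) [Fintype σ], Fintype.card σ = n →
      ∀ (x : σ → S) (ρ : ℕ → S),
      ∏ i, (Polynomial.X - Polynomial.C (x i)) =
        Polynomial.X ^ n - ∑ k ∈ Finset.range n, Polynomial.C (ρ k) * Polynomial.X ^ k →
      ∑ i, x i ^ j = MvPolynomial.aeval (fun k : Fin n => ρ k) P := by
  obtain ⟨P, hP⟩ := MvPolynomial.esymmAlgHom_surjective (σ := Fin n) ℂ (n := n) (by simp)
    ⟨MvPolynomial.psum (Fin n) ℂ j, MvPolynomial.psum_isSymmetric (Fin n) ℂ j⟩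
  -- By Vieta, the elementary symmetric function of degree k + 1 is (-1)^(k+1) times the coefficient
  -- of X^(n-1-k), which is −ρ at n − 1 − k, the value of `k.rev`.
  refine ⟨MvPolynomial.aeval (fun k : Fin n =>
    (-1 : MvPolynomial (Fin n) ℂ) ^ ((k : ℕ) + 1) * -MvPolynomial.X k.rev) P, ?_⟩
  intro S _ _ σ _ hσ x ρ hx
  set e : σ ≃ Fin n := Fintype.equivFinOfCardEq hσ
  set y : Fin n → S := fun i => x (e.symm i)
  have hsum : ∑ i, x i ^ j = ∑ i, y i ^ j := (Equiv.sum_comp e.symm (fun i => x i ^ j)).symm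
  have hprod : ∏ i, (Polynomial.X - Polynomial.C (x i)) =
      ((Finset.univ.val.map y).map fun t => Polynomial.X - Polynomial.C t).prod := by
    rw [Multiset.map_map, ← Equiv.prod_comp e.symm]
    rfl
  have hcard : Multiset.card (Finset.univ.val.map y) = n := by simp
  have hval := congrArg Subtype.val hP
  rw [MvPolynomial.esymmAlgHom_apply] at hval
  have hps : ∑ i, y i ^ j = MvPolynomial.aeval y (MvPolynomial.psum (Fin n) ℂ j) := by
    simp [MvPolynomial.psum]
  rw [hsum, hps]
  change _ = MvPolynomial.psum (Fin n) ℂ j at hval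
  rw [← hval, ← AlgHom.comp_apply, ← AlgHom.comp_apply, MvPolynomial.comp_aeval,
    MvPolynomial.comp_aeval]
  congr 2
  funext k
  have hk : n - ((k.rev : Fin n) : ℕ) = (k : ℕ) + 1 := by
    rw [Fin.val_rev]; omega
  have h1 := Multiset.prod_X_sub_C_coeff (Finset.univ.val.map y) (k := (k.rev : Fin n))
    (by rw [hcard]; exact k.rev.2.le)
  rw [← hprod, hx, hcard, hk] at h1
  rw [MvPolynomial.aeval_esymm_eq_multiset_esymm]
  simp only [Polynomial.coeff_sub, Polynomial.coeff_X_pow, Polynomial.finsetSum_coeff,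
    Polynomial.coeff_C_mul, mul_ite, mul_one, mul_zero, Finset.sum_ite_eq, Finset.mem_range,
    k.rev.2.ne, k.rev.2, if_true, if_false, zero_sub] at h1
  simp only [map_mul, map_pow, map_neg, map_one, MvPolynomial.aeval_X]
  rw [h1, ← mul_assoc, ← mul_pow]
  simp

variable {n : ℕ} {α : PowerSeries ℂ}

theorem rescale_expandSeries {ε : ℂ} (hε : ε ^ n = 1) (g : ℕ → ℂ) :
    rescale ε (expandSeries n g) = expandSeries n g := by
  ext l
  rw [coeff_rescale, expandSeries, coeff_mk]
  split_ifs with h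
  · obtain ⟨k, rfl⟩ := h
    rw [pow_mul, hε, one_pow, one_mul]
  · rw [mul_zero]

/-- The conjugates of a Puiseux parametrisation are distinct. -/
theorem IsPuiseux.eq_of_rescale_eq (h : IsPuiseux n α) {ε ε' : ℂ} (hε : ε ^ n = 1)
    (hε' : ε' ^ n = 1) (heq : rescale ε α = rescale ε' α) : ε = ε' := by
  have h0 : ε' ≠ 0 := by
    rintro rfl
    rw [zero_pow h.pos.ne'] at hε'
    exact zero_ne_one hε'
  have h1 : (ε / ε') ^ n = 1 := by rw [div_pow, hε, hε', div_one]
  have h2 := h.gcd_eq_one (orderOf (ε / ε')) (orderOf_dvd_of_pow_eq_one h1) fun i hi => by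
    apply orderOf_dvd_of_pow_eq_one
    have := congrArg (coeff i) heq
    rw [coeff_rescale, coeff_rescale] at this
    rw [div_pow, mul_right_cancel₀ hi this, div_self (pow_ne_zero _ h0)]
  exact (div_eq_one_iff_eq h0).1 (orderOf_eq_one_iff.1 h2)

/-- A monic polynomial over `ℂ[[T^n]]` of degree `n` which vanishes at a Puiseux parametrisation is
the product over its conjugates. -/
theorem IsPuiseux.prod_X_sub_C (h : IsPuiseux n α) (g : ℕ → ℕ → ℂ)
    (hg : α ^ n = ∑ k ∈ Finset.range n, expandSeries n (g k) * α ^ k) :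
    ∏ ε ∈ Polynomial.nthRootsFinset n (1 : ℂ), (Polynomial.X - Polynomial.C (rescale ε α)) =
      Polynomial.X ^ n -
        ∑ k ∈ Finset.range n, Polynomial.C (expandSeries n (g k)) * Polynomial.X ^ k := by
  classical
  set W : Polynomial (PowerSeries ℂ) := Polynomial.X ^ n -
    ∑ k ∈ Finset.range n, Polynomial.C (expandSeries n (g k)) * Polynomial.X ^ k with hW
  have hdeg : (∑ k ∈ Finset.range n, Polynomial.C (expandSeries n (g k)) *
      Polynomial.X ^ k : Polynomial (PowerSeries ℂ)).degree < n := by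
    refine (Polynomial.degree_sum_le _ _).trans_lt ?_
    refine (Finset.sup_lt_iff (WithBot.bot_lt_coe n)).2 fun k hk => ?_
    exact (Polynomial.degree_C_mul_X_pow_le _ _).trans_lt
      (WithBot.coe_lt_coe.2 (Finset.mem_range.1 hk))
  have hmonic : W.Monic := Polynomial.monic_X_pow_sub hdeg
  have hWdeg : W.natDegree = n := by
    refine Polynomial.natDegree_eq_of_degree_eq_some ?_
    rw [hW, Polynomial.degree_sub_eq_left_of_degree_lt, Polynomial.degree_X_pow]
    rwa [Polynomial.degree_X_pow]
  have hinj : Set.InjOn (fun ε : ℂ => rescale ε α)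
      (Polynomial.nthRootsFinset n (1 : ℂ) : Set ℂ) := by
    intro ε hε ε' hε' heq
    rw [Finset.mem_coe, Polynomial.mem_nthRootsFinset h.pos] at hε hε'
    exact h.eq_of_rescale_eq hε hε' heq
  set S : Finset (PowerSeries ℂ) :=
    (Polynomial.nthRootsFinset n (1 : ℂ)).image fun ε => rescale ε α with hS
  have hcard : S.card = n := by
    rw [hS, Finset.card_image_of_injOn hinj]
    exact (Complex.isPrimitiveRoot_exp n h.pos.ne').card_nthRootsFinset
  -- Each conjugate is a root, since T ↦ εT fixes series in T^n. There are n distinct ones, so they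
  -- exhaust the roots of W.
  have hle : S.val ≤ W.roots := by
    refine Finset.val_le_iff_val_subset.2 fun x hx => ?_
    replace hx : x ∈ S := hx
    obtain ⟨ε, hε, rfl⟩ := Finset.mem_image.1 hx
    rw [Polynomial.mem_nthRootsFinset h.pos] at hε
    rw [Polynomial.mem_roots hmonic.ne_zero, Polynomial.IsRoot.def, hW]
    have := congrArg (rescale ε) hg
    simp only [map_pow, map_sum, map_mul, rescale_expandSeries hε] at this
    simp [Polynomial.eval_finsetSum, this]
  have heq : S.val = W.roots := by
    refine Multiset.eq_of_le_of_card_le hle ?_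
    rw [Finset.card_val, hcard]
    exact (Polynomial.card_roots' W).trans hWdeg.le
  have := Polynomial.prod_multiset_X_sub_C_of_monic_of_roots_card_eq hmonic
    (by rw [← heq, Finset.card_val, hcard, hWdeg])
  rw [← this, ← heq]
  exact (Finset.prod_image (f := fun x => Polynomial.X - Polynomial.C x) hinj).symm

/-- The coefficients of `α^j` at exponents divisible by `n` lie in the ring `G`. -/
theorem coeff_pow_mem {ι : Type} {G : Subalgebra ℂ (ι → ℂ)} {α : ι → PowerSeries ℂ}
    (hn : 0 < n) (hα : ∀ p, IsPuiseux n (α p)) (g : ℕ → ℕ → G)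
    (hg : ∀ p, α p ^ n =
      ∑ k ∈ Finset.range n, expandSeries n (fun i => (g k i : ι → ℂ) p) * α p ^ k) (j l : ℕ) :
    (fun p => coeff (n * l) (α p ^ j)) ∈ G := by
  obtain ⟨P, hP⟩ := exists_powerSum_polynomial n j
  -- The universal polynomial is evaluated over G, so the coefficients of Z are in G; at each p it
  -- gives the sum over ε of α(εT)^j, whose coefficient at T^(nl) is n times that of α^j.
  set Z : PowerSeries G := MvPolynomial.aeval (fun k : Fin n => expandSeries n (g k)) P with hZ
  have hn0 : (n : ℂ) ≠ 0 := by exact_mod_cast hn.ne'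
  have key : (fun p => coeff (n * l) (α p ^ j)) =
      (n : ℂ)⁻¹ • ((coeff (n * l) Z : G) : ι → ℂ) := by
    funext p
    set ev : G →ₐ[ℂ] ℂ := (Pi.evalAlgHom ℂ (fun _ : ι => ℂ) p).comp G.val
    have h1 : PowerSeries.mapAlgHom ev Z = MvPolynomial.aeval
        (fun k : Fin n => expandSeries n (fun i => (g k i : ι → ℂ) p)) P := by
      rw [hZ, ← AlgHom.comp_apply, MvPolynomial.comp_aeval]
      congr 2
      funext k
      ext i
      simp only [expandSeries, PowerSeries.mapAlgHom_apply, coeff_map, coeff_mk]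
      split_ifs
      · rfl
      · exact map_zero ev
    have h2 := hP (PowerSeries ℂ) (Polynomial.nthRootsFinset n (1 : ℂ)) (by
      rw [Fintype.card_coe]
      exact (Complex.isPrimitiveRoot_exp n hn.ne').card_nthRootsFinset)
      (fun ε => rescale (ε : ℂ) (α p)) (fun k => expandSeries n (fun i => (g k i : ι → ℂ) p))
      ((Finset.prod_coe_sort (Polynomial.nthRootsFinset n (1 : ℂ))
        (fun ε => Polynomial.X - Polynomial.C (rescale ε (α p)))).trans
        ((hα p).prod_X_sub_C _ (hg p)))
    rw [← h1, Finset.sum_coe_sort (Polynomial.nthRootsFinset n (1 : ℂ))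
      (fun ε => rescale ε (α p) ^ j)] at h2
    have h3 := congrArg (coeff (n * l)) h2
    rw [map_sum, Finset.sum_congr rfl (g := fun _ => coeff (n * l) (α p ^ j)), Finset.sum_const,
      (Complex.isPrimitiveRoot_exp n hn.ne').card_nthRootsFinset, nsmul_eq_mul] at h3
    · rw [Pi.smul_apply, smul_eq_mul, eq_inv_mul_iff_mul_eq₀ hn0, h3]
      rfl
    · intro ε hε
      rw [Polynomial.mem_nthRootsFinset hn] at hε
      rw [← map_pow, coeff_rescale, pow_mul, hε, one_pow, one_mul]
  rw [key]
  exact G.smul_mem (coeff (n * l) Z).2 _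

/-- Two Puiseux parametrisations satisfying the same equation are conjugate. -/
theorem IsPuiseux.exists_eq_rescale (h : IsPuiseux n α) {α' : PowerSeries ℂ} (g : ℕ → ℕ → ℂ)
    (hg : α ^ n = ∑ k ∈ Finset.range n, expandSeries n (g k) * α ^ k)
    (hg' : α' ^ n = ∑ k ∈ Finset.range n, expandSeries n (g k) * α' ^ k) :
    ∃ ε : ℂ, ε ^ n = 1 ∧ α' = rescale ε α := by
  have h1 := congrArg (Polynomial.eval α') (h.prod_X_sub_C g hg)
  rw [Polynomial.eval_prod] at h1
  simp only [Polynomial.eval_sub, Polynomial.eval_X, Polynomial.eval_C, Polynomial.eval_pow,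
    Polynomial.eval_finsetSum, Polynomial.eval_mul, ← hg', sub_self] at h1
  obtain ⟨ε, hε, h2⟩ := Finset.prod_eq_zero_iff.1 h1
  exact ⟨ε, (Polynomial.mem_nthRootsFinset h.pos _).1 hε, sub_eq_zero.1 h2⟩

theorem supp_rescale {ε : ℂ} (hε : ε ≠ 0) (α : PowerSeries ℂ) : supp (rescale ε α) = supp α := by
  ext i
  simp [supp, coeff_rescale, hε]

end PowerSums

/-! ### The ring G of rational functions of the coefficients -/

section RationalFunctions

/-- The functions of `p` which are quotients, with nowhere vanishing denominator, of polynomials in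
the functions `c γ`. -/
def quotientAlgebra {ι κ : Type*} (c : κ → ι → ℂ) : Subalgebra ℂ (ι → ℂ) where
  carrier := {F | ∃ N D : MvPolynomial κ ℂ, ∀ p,
    MvPolynomial.eval (fun γ => c γ p) D ≠ 0 ∧
      F p * MvPolynomial.eval (fun γ => c γ p) D = MvPolynomial.eval (fun γ => c γ p) N}
  mul_mem' := by
    rintro F F' ⟨N, D, h⟩ ⟨N', D', h'⟩
    refine ⟨N * N', D * D', fun p => ⟨?_, ?_⟩⟩
    · rw [map_mul]; exact mul_ne_zero (h p).1 (h' p).1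
    · rw [map_mul, map_mul, ← (h p).2, ← (h' p).2, Pi.mul_apply]; ring
  add_mem' := by
    rintro F F' ⟨N, D, h⟩ ⟨N', D', h'⟩
    refine ⟨N * D' + N' * D, D * D', fun p => ⟨?_, ?_⟩⟩
    · rw [map_mul]; exact mul_ne_zero (h p).1 (h' p).1
    · rw [map_mul, map_add, map_mul, map_mul, ← (h p).2, ← (h' p).2, Pi.add_apply]; ring
  algebraMap_mem' := fun x => ⟨MvPolynomial.C x, 1, fun p => by simp⟩

theorem mem_quotientAlgebra {ι κ : Type*} (c : κ → ι → ℂ) (γ : κ) : c γ ∈ quotientAlgebra c :=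
  ⟨MvPolynomial.X γ, 1, fun p => by simp⟩

/-- A unit vanishes nowhere, hence neither does its numerator, and the fraction can be inverted. -/
theorem inv_mem_quotientAlgebra {ι κ : Type*} (c : κ → ι → ℂ) (u : (ι → ℂ)ˣ)
    (hu : (u : ι → ℂ) ∈ quotientAlgebra c) : ((u⁻¹ : (ι → ℂ)ˣ) : ι → ℂ) ∈ quotientAlgebra c := by
  obtain ⟨N, D, h⟩ := hu
  have hinv : ∀ p, (u : ι → ℂ) p * ((u⁻¹ : (ι → ℂ)ˣ) : ι → ℂ) p = 1 := fun p =>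
    congrFun (Units.mul_inv u) p
  refine ⟨D, N, fun p => ⟨?_, ?_⟩⟩
  · rw [← (h p).2]
    exact mul_ne_zero (left_ne_zero_of_mul_eq_one (hinv p)) (h p).1
  · rw [← (h p).2, ← mul_assoc, mul_comm (((u⁻¹ : (ι → ℂ)ˣ) : ι → ℂ) p), hinv, one_mul]

end RationalFunctions

/-! ### Characteristic sequences and gcds -/

section Characteristic

theorem IsCharacteristic.of_supp_eq {n m : ℕ} {α α' : PowerSeries ℂ} {b : Fin (m + 1) → ℕ}
    (h : IsCharacteristic n α b) (hs : supp α' = supp α) : IsCharacteristic n α' b :=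
  ⟨h.zero, fun k => by rw [hs]; exact h.succ k, h.last⟩

/-- The greatest common divisor of `b_0` and of all `b_k < i`, `k > 0`. -/
def gcdBelow {m : ℕ} (b : Fin (m + 1) → ℕ) (i : ℕ) : ℕ :=
  (Finset.univ.filter fun k => k = 0 ∨ b k < i).gcd b

variable {m : ℕ} {b : Fin (m + 1) → ℕ}

theorem gcdBelow_zero : gcdBelow b 0 = b 0 := by
  have : (Finset.univ.filter fun k : Fin (m + 1) => k = 0 ∨ b k < 0) = {0} := by
    ext k; simp
  rw [gcdBelow, this, Finset.gcd_singleton, normalize_eq]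

theorem gcdBelow_dvd {i : ℕ} {k : Fin (m + 1)} (hk : k = 0 ∨ b k < i) : gcdBelow b i ∣ b k :=
  Finset.gcd_dvd (by simpa using hk)

theorem gcdBelow_succ_of_forall_ne {i : ℕ} (h : ∀ k : Fin m, b k.succ ≠ i) :
    gcdBelow b (i + 1) = gcdBelow b i := by
  unfold gcdBelow
  congr 1
  ext k
  simp only [Finset.mem_filter, Finset.mem_univ, true_and]
  refine or_congr_right' fun hk => ?_
  obtain ⟨k, rfl⟩ := Fin.exists_succ_eq.2 hk
  have := h k
  omega

theorem gcdBelow_succ_of_eq {i : ℕ} {k : Fin m} (h : b k.succ = i) :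
    gcdBelow b (i + 1) = (gcdBelow b i).gcd i := by
  apply Nat.dvd_antisymm
  · refine Nat.dvd_gcd (Finset.dvd_gcd fun j hj => ?_) ?_
    · apply gcdBelow_dvd
      simp only [Finset.mem_filter, Finset.mem_univ, true_and] at hj
      omega
    · conv_rhs => rw [← h]
      exact gcdBelow_dvd (Or.inr (by omega))
  · refine Finset.dvd_gcd fun j hj => ?_
    simp only [Finset.mem_filter, Finset.mem_univ, true_and] at hj
    by_cases hj' : j = 0 ∨ b j < i
    · exact (Nat.gcd_dvd_left _ _).trans (gcdBelow_dvd hj')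
    · have : b j = i := by omega
      rw [this]
      exact Nat.gcd_dvd_right _ _

/-- A support element which is not one of the `b_k` is divisible by the `gcd` of the previous
`b_k`. -/
theorem IsCharacteristic.gcdBelow_dvd {n : ℕ} {α : PowerSeries ℂ} (h : IsCharacteristic n α b)
    {i : ℕ} (hi : i ∈ supp α) (hne : ∀ k : Fin m, b k.succ ≠ i) : gcdBelow b i ∣ i := by
  classical
  have hex : ∃ k : ℕ, ∃ hk : k < m + 1, e b ⟨k, hk⟩ ∣ i :=
    ⟨m, m.lt_succ_self, by
      have := h.last
      change e b ⟨m, _⟩ = 1 at this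
      rw [this]; exact one_dvd _⟩
  -- Take the least k with e_k ∣ i. For j < k, e_j does not divide i, so b_(j+1) ≤ i by minimality
  -- of b_(j+1), and equality is excluded.
  obtain ⟨hk, hdvd⟩ := Nat.find_spec hex
  refine dvd_trans (Finset.dvd_gcd fun j hj => PlaneBranch.gcdBelow_dvd ?_) hdvd
  rw [Finset.mem_Iic] at hj
  refine or_iff_not_imp_left.2 fun hj0 => ?_
  obtain ⟨j, rfl⟩ := Fin.exists_succ_eq.2 hj0
  have hlt : (j : ℕ) < Nat.find hex := by
    have : ((j.succ : Fin (m + 1)) : ℕ) ≤ Nat.find hex := hj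
    rw [Fin.val_succ] at this
    omega
  have hnd : ¬ e b j.castSucc ∣ i := fun hd =>
    Nat.find_min hex hlt ⟨j.castSucc.2, hd⟩
  exact lt_of_le_of_ne ((h.succ j).2 ⟨hi, hnd⟩) (hne j)

theorem gcdBelow_eq_one (hb : e b (Fin.last m) = 1) {i : ℕ} (hi : ∀ k, b k < i) :
    gcdBelow b i = 1 := by
  rw [← hb, gcdBelow, e]
  congr 1
  ext k
  simp [hi, Fin.le_last]

end Characteristic

/-! ### The induction and the conclusion -/

/-- All coefficients of `α` are known up to `G` and up to powers of one unit. -/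
theorem exists_stage {ι : Type} {m n : ℕ} {b : Fin (m + 1) → ℕ} {G : Subalgebra ℂ (ι → ℂ)}
    (hG : ∀ u : (ι → ℂ)ˣ, (u : ι → ℂ) ∈ G → ((u⁻¹ : (ι → ℂ)ˣ) : ι → ℂ) ∈ G)
    {α : PowerSeries (ι → ℂ)} (hα : ∀ j l, coeff (n * l) (α ^ j) ∈ G) (hn : 0 < n)
    (hchar : ∀ p, IsCharacteristic n (PowerSeries.map (Pi.evalRingHom _ p) α) b)
    (hb0 : b 0 = n) (i : ℕ) : ∃ v, Stage G α n i (gcdBelow b i) v := by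
  induction i with
  | zero => exact ⟨1, by rw [gcdBelow_zero, hb0]; exact Stage.initial⟩
  | succ i ih =>
    obtain ⟨v, hv⟩ := ih
    by_cases h : ∃ k : Fin m, b k.succ = i
    · obtain ⟨k, hk⟩ := h
      rw [gcdBelow_succ_of_eq hk]
      refine hv.succ_of_isUnit hG hα hn (Pi.isUnit_iff.2 fun p => isUnit_iff_ne_zero.2 ?_)
      have := ((hchar p).succ k).1.1
      rwa [hk] at this
    · push Not at h
      rw [gcdBelow_succ_of_forall_ne h]
      refine ⟨v, hv.succ_of_dvd hG hα hn ?_⟩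
      by_cases hd : gcdBelow b i ∣ i
      · exact Or.inl hd
      · refine Or.inr (funext fun p => ?_)
        by_contra hne
        exact hd ((hchar p).gcdBelow_dvd hne h)

end PlaneBranch

open PlaneBranch in
/-- One polynomial `W` works for all branches `f` of the class and all their Puiseux
parametrisations. -/
theorem theorem6p1 {m : ℕ} (b : Fin (m + 1) → ℕ) (hb : ∀ k, 0 < b k)
    (s : Finset ℕ) (hs : (s : Set ℕ) ⊆ PlaneBranch.indexSet b)
    (Q : MvPolynomial s ℂ)
    (hQ : ∀ ε : ℂ, ε ^ (b 0) = 1 → ∀ A : s → ℂ,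
      (MvPolynomial.eval A Q = 0 ↔
        MvPolynomial.eval (fun i : s => ε ^ (i : ℕ) * A i) Q = 0)) :
    ∃ (Γ : Finset (ℕ × ℕ)) (W : MvPolynomial Γ ℂ),
      ∀ f ∈ PlaneBranch.ClassFHat b, ∀ α : PowerSeries ℂ, PlaneBranch.IsPuiseuxOf f (b 0) α →
        (MvPolynomial.eval (fun i : s => PowerSeries.coeff (i : ℕ) α) Q = 0 ↔
          MvPolynomial.eval
            (fun γ : Γ => PlaneBranch.coeffXY f (γ : ℕ × ℕ).1 (γ : ℕ × ℕ).2) W = 0) := by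
  classical
  have hn := hb 0
  -- Points are pairs, since the a_i are functions of the chosen parametrisation and not of f alone.
  let ι : Type := {p : Series2 × PowerSeries ℂ // p.1 ∈ ClassFHat b ∧ IsPuiseuxOf p.1 (b 0) p.2}
  let c : ℕ × ℕ → ι → ℂ := fun γ p => coeffXY p.1.1 γ.1 γ.2
  set G := quotientAlgebra c
  have hG := inv_mem_quotientAlgebra c
  have hord : ∀ p : ι, (∀ j < b 0, coeffXY p.1.1 0 j = 0) ∧ coeffXY p.1.1 0 (b 0) ≠ 0 := by
    intro p
    obtain ⟨-, w, hw, -⟩ := p.2.1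
    exact ⟨hw.coeff_lt, hw.coeff_ne⟩
  obtain ⟨g, hg⟩ := exists_monic_relation hG (f := fun p : ι => p.1.1)
    (fun i j => mem_quotientAlgebra c (i, j)) hn (fun p => (hord p).1) (fun p => (hord p).2)
  have hrel : ∀ p : ι, _ := fun p => hg p p.1.2 p.2.2.1.constantCoeff_eq_zero p.2.2.2
  -- The parametrisation is conjugate to the one of characteristic b provided by the class, hence
  -- has the same support.
  have hchar : ∀ p : ι, IsCharacteristic (b 0) p.1.2 b := by
    intro p
    obtain ⟨-, w, hw, -, -, α₀, h₀, hc⟩ := p.2.1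
    obtain ⟨u, -, hu⟩ := hw.factor
    have hf : substPair (b 0) α₀ p.1.1 = 0 := by
      have h1 := h₀.2
      unfold substPair at h1 ⊢
      rw [hu, MvPowerSeries.subst_mul (hasSubst_pair hn h₀.1.constantCoeff_eq_zero), h1, mul_zero]
    obtain ⟨ε, hε, heq⟩ := h₀.1.exists_eq_rescale _
      (hg p α₀ h₀.1.constantCoeff_eq_zero hf) (hrel p)
    refine hc.of_supp_eq ?_
    rw [heq]
    refine supp_rescale ?_ _
    rintro rfl
    rw [zero_pow hn.ne'] at hε
    exact zero_ne_one hε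
  -- A point is needed to know that gcd(b_0, …, b_m) = 1; without points any W serves.
  rcases isEmpty_or_nonempty ι with hempty | ⟨⟨p₀⟩⟩
  · exact ⟨∅, 0, fun f hf α hα => (hempty.false ⟨(f, α), hf, hα⟩).elim⟩
  set α : PowerSeries (ι → ℂ) := PowerSeries.mk fun i p => PowerSeries.coeff i p.1.2 with hαdef
  have hmap : ∀ p, PowerSeries.map (Pi.evalRingHom (fun _ : ι => ℂ) p) α = p.1.2 := by
    intro p
    ext i
    rw [PowerSeries.coeff_map, hαdef, PowerSeries.coeff_mk]
    rfl
  have hα : ∀ j l, PowerSeries.coeff (b 0 * l) (α ^ j) ∈ G := by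
    intro j l
    convert coeff_pow_mem hn (fun p : ι => p.2.2.1) g hrel j l using 1
    funext p
    rw [← hmap p, ← map_pow, PowerSeries.coeff_map]
    rfl
  have hlast := (hchar p₀).last
  obtain ⟨i, hib, his⟩ : ∃ i, (∀ k, b k < i) ∧ ∀ j ∈ s, j < i := by
    refine ⟨(Finset.univ.sup b) + s.sup id + 1, fun k => ?_, fun j hj => ?_⟩
    · have : b k ≤ Finset.univ.sup b := Finset.le_sup (Finset.mem_univ k)
      omega
    · have : id j ≤ s.sup id := Finset.le_sup hj
      rw [id] at this
      omega
  obtain ⟨v, hv⟩ := exists_stage hG hα hn (fun p => by rw [hmap]; exact hchar p) rfl i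
  rw [gcdBelow_eq_one hlast hib] at hv
  have hdeg : ∀ j : s, PowerSeries.coeff (j : ℕ) α * ((v ^ (-((j : ℕ) : ℤ)) : _ˣ) : ι → ℂ) ∈ G := by
    intro j
    have := (hv.coeff_deg j (his j j.2)).1
    rwa [Nat.div_one] at this
  -- Substituting (a_j v^(-j)) Y^j for A_j in Q gives a polynomial over G whose value at ωv is Q(ω^j
  -- a_j).
  set P : Polynomial G := MvPolynomial.aeval
    (fun j : s => Polynomial.C (⟨_, hdeg j⟩ : G) * Polynomial.X ^ (j : ℕ)) Q with hP
  have hPv : ∀ ω : ℂ, Polynomial.aeval (ω • (v : ι → ℂ)) P =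
      fun p => MvPolynomial.eval (fun j : s => ω ^ (j : ℕ) * PowerSeries.coeff (j : ℕ) p.1.2) Q := by
    intro ω
    funext p
    let ψ : Polynomial G →ₐ[ℂ] ℂ := (Pi.evalAlgHom ℂ (fun _ : ι => ℂ) p).comp
      ((Polynomial.aeval (ω • (v : ι → ℂ)) : Polynomial G →ₐ[G] (ι → ℂ)).restrictScalars ℂ)
    change ψ P = _
    rw [hP, ← AlgHom.comp_apply, MvPolynomial.comp_aeval, ← MvPolynomial.coe_aeval_eq_eval,
      RingHom.coe_coe]
    congr 2
    funext j
    change (Polynomial.aeval (ω • (v : ι → ℂ)) (_ * _)) p = _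
    rw [map_mul, Polynomial.aeval_C, map_pow, Polynomial.aeval_X]
    change (PowerSeries.coeff (j : ℕ) α p * ((v ^ (-((j : ℕ) : ℤ)) : _ˣ) : ι → ℂ) p) *
      (ω * (v : ι → ℂ) p) ^ (j : ℕ) = _
    have h1 : ((v ^ (-((j : ℕ) : ℤ)) : _ˣ) : ι → ℂ) p * (v : ι → ℂ) p ^ (j : ℕ) = 1 := by
      have h2 : ((v ^ (-((j : ℕ) : ℤ)) * v ^ (j : ℕ) : _ˣ) : ι → ℂ) p = 1 := by
        rw [zpow_neg, zpow_natCast, inv_mul_cancel]; rfl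
      exact h2
    rw [mul_pow, mul_mul_mul_comm, h1, mul_one, mul_comm, hαdef,
      PowerSeries.coeff_mk]
  have hmem := prod_aeval_smul_mem G P hn (v : ι → ℂ) (by simpa using hv.pow_mem)
  obtain ⟨N, D, hND⟩ := hmem
  -- The numerator N involves only finitely many of the variables c_γ; these form Γ.
  obtain ⟨Γ, W, hW⟩ := MvPolynomial.exists_finset_rename N
  refine ⟨Γ, W, fun f hf α' hα' => ?_⟩
  obtain ⟨hD, hN⟩ := hND ⟨(f, α'), hf, hα'⟩
  rw [hW, MvPolynomial.eval_rename] at hN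
  change _ = MvPolynomial.eval (fun γ : Γ => coeffXY f (γ : ℕ × ℕ).1 (γ : ℕ × ℕ).2) W at hN
  rw [← hN, mul_eq_zero, or_iff_left hD, Finset.prod_apply, Finset.prod_eq_zero_iff]
  simp only [hPv]
  constructor
  · intro h
    exact ⟨1, Polynomial.one_mem_nthRootsFinset hn, by simpa using h⟩
  · rintro ⟨ω, hω, h⟩
    exact (hQ ω ((Polynomial.mem_nthRootsFinset hn _).1 hω) _).2 h
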